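/- **Setting.** Let $X$ be a finite connected simple graph with at least one edge, embedded on a closed oriented surface with all faces open discs, given by its rotation system: at each vertex, a cyclic permutation of the arcs leaving that vertex. Orienting the face boundaries consistently, every arc $(u,v)$ lies in exactly one facial walk. Let $M$ be the arc-face incidence matrix and $N$ the arc-tail incidence matrix (the tail of $(u,v)$ is $u$), and let $\widehat M,\widehat N$ be obtained from $M,N$ by scaling each column to a unit vector. The vertex-face transition matrix of the embedding is $$U=(2\widehat M\widehat M^T-I)(2\widehat N\widehat N^T-I).$$ The embedding is *orientably-regular* if its group of orientation-preserving automorphisms (the automorphisms of $X$ that preserve the rotation system) acts regularly on the arcs. It is *self-dual* if its dual graph (whose vertices are the faces, each edge of $X$ giving an edge between the faces that contain its two arcs) is isomorphic to $X$. **Statement.** Let $S$ be any set of prime powers $n$ and, for each $n\in S$, let $U_n$ be the vertex-face transition matrix of a self-dual orientably-regular embedding of the complete graph $K_n$. Then the quantum walks determined by $\{U_n : n\in S\}$ form a sedentary family: for every step $t\in\mathbb{N}$, the mixing matrices $U_n^t\circ\overline{U_n^t}$ (entrywise product) converge to $I$ as $n\to\infty$ in $S$. Since the size of the matrices grows with $n$,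 convergence is meant in the maximum row sum norm: $$\max_{a}\sum_{b}\Bigl|\bigl(U_n^t\circ\overline{U_n^t}-I\bigr)_{a,b}\Bigr|\longrightarrow 0\qquad(n\to\infty,\ n\in S),$$ where $a,b$ run over the arcs of $K_n$. (As $U_n$ is unitary, this is equivalent to the entries converging uniformly.) -/

import Mathlib

noncomputable section

/-- An embedding of a graph `G` (connected, with at least one edge) on a closed oriented surface
with all faces open discs, given by its rotation system: at every vertex `v`, `rot` permutes
cyclically the arcs with tail `v` (their order around `v` on the surface).  Arcs are the darts
of `G`; the arc `(u, v)` has tail `u`. -/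
structure RotationSystem {V : Type*} (G : SimpleGraph V) where
  rot : Equiv.Perm G.Dart
  rot_fst : ∀ d : G.Dart, (rot d).fst = d.fst
  rot_cyclic : ∀ d e : G.Dart, d.fst = e.fst → rot.SameCycle d e

namespace RotationSystem

variable {V : Type*} {G : SimpleGraph V} (M : RotationSystem G)

/-- Face tracing: the successor, in its facial walk, of an arc `(u, v)` is the arc that follows
`(v, u)` in the rotation at `v`.  Every arc lies in exactly one facial walk, and the two arcs of
an edge are traversed by the facial walks in opposite directions, so this is a consistent
orientation of the faces (the opposite one belongs to the rotation system `rot⁻¹`). -/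
def facePerm : Equiv.Perm G.Dart :=
  (Function.Involutive.toPerm SimpleGraph.Dart.symm SimpleGraph.Dart.symm_involutive).trans M.rot

/-- The faces: the cycles of face tracing. -/
def Face : Type _ := Quotient (Equiv.Perm.SameCycle.setoid M.facePerm)

/-- The unique face whose facial walk uses the arc `d`. -/
def faceOf (d : G.Dart) : M.Face := Quotient.mk _ d

instance [Fintype V] [DecidableEq V] [DecidableRel G.Adj] : Fintype M.Face := by
  classical
  exact Quotient.fintype _

/-- The group of orientation-preserving automorphisms of the embedding: the automorphisms of
the graph that preserve the rotation at every vertex. -/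
def aut : Subgroup (G ≃g G) where
  carrier := {σ | ∀ d : G.Dart, σ.toHom.mapDart (M.rot d) = M.rot (σ.toHom.mapDart d)}
  one_mem' := fun _ => rfl
  mul_mem' := by
    intro σ τ hσ hτ d
    have h := hσ (τ.toHom.mapDart d)
    rw [← hτ d] at h
    exact h
  inv_mem' := by
    intro σ hσ d
    have key : ∀ e : G.Dart, σ.toHom.mapDart ((σ⁻¹).toHom.mapDart e) = e := fun e =>
      SimpleGraph.Dart.ext _ _ (Prod.ext (RelIso.apply_inv_self σ _) (RelIso.apply_inv_self σ _))
    have key' : ∀ e : G.Dart, (σ⁻¹).toHom.mapDart (σ.toHom.mapDart e) = e := fun e =>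
      SimpleGraph.Dart.ext _ _ (Prod.ext (RelIso.inv_apply_self σ _) (RelIso.inv_apply_self σ _))
    have h := hσ ((σ⁻¹).toHom.mapDart d)
    rw [key] at h
    rw [← h, key']

/-- The embedding is orientably-regular: its orientation-preserving automorphism group acts
regularly (sharply transitively) on the arcs. -/
def IsOrientablyRegular : Prop :=
  ∀ d e : G.Dart, ∃! σ : M.aut, (σ : G ≃g G).toHom.mapDart d = e

/-- The embedding is self-dual: its dual graph is isomorphic to `G`.  The dual graph has the
faces as vertices, and every arc `d` of `G` gives an arc of it, from the face of `d` to the face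
of the reversed arc `d.symm`; an isomorphism is a bijection on vertices together with a
bijection on arcs which respects reversal and tails (so also heads). -/
def IsSelfDual : Prop :=
  ∃ (f : M.Face ≃ V) (g : G.Dart ≃ G.Dart),
    (∀ d, g d.symm = (g d).symm) ∧ ∀ d, (g d).fst = f (M.faceOf d)

open Classical in
/-- The arc-face incidence matrix. -/
def arcFace : Matrix G.Dart M.Face ℝ :=
  Matrix.of fun d f => if M.faceOf d = f then 1 else 0

end RotationSystem

open Classical in
/-- The arc-tail incidence matrix. -/
def arcTail {V : Type*} (G : SimpleGraph V) : Matrix G.Dart V ℝ :=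
  Matrix.of fun d v => if d.fst = v then 1 else 0

/-- Scale every column of a matrix to a unit vector. -/
def normalizeCols {m k : Type*} [Fintype m] (A : Matrix m k ℝ) : Matrix m k ℝ :=
  Matrix.of fun i j => A i j / √(∑ i', A i' j ^ 2)

/-- The vertex-face transition matrix `(2 M̂ M̂ᵀ - I) (2 N̂ N̂ᵀ - I)`, as a complex matrix. -/
def RotationSystem.transition {V : Type*} [Fintype V] [DecidableEq V] {G : SimpleGraph V}
    [DecidableRel G.Adj] (M : RotationSystem G) : Matrix G.Dart G.Dart ℂ :=
  (((2 : ℝ) • (normalizeCols M.arcFace * (normalizeCols M.arcFace).transpose) - 1) *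
    ((2 : ℝ) • (normalizeCols (arcTail G) * (normalizeCols (arcTail G)).transpose) - 1)).map
      Complex.ofReal

/-- The mixing matrix at step `t`: the entrywise product of `U ^ t` and its complex conjugate. -/
def mixingMatrix {A : Type*} [Fintype A] [DecidableEq A] (U : Matrix A A ℂ) (t : ℕ) :
    Matrix A A ℂ :=
  Matrix.hadamard (U ^ t) ((U ^ t).map star)

/-- A family of discrete quantum walks, with transition matrices `U n` indexed by a set `S` of
natural numbers, is sedentary if for every step `t` its mixing matrices converge to the identity
as `n` goes to infinity in `S`.  The size of the matrices varies with `n`; convergence is meant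
in the maximum row sum norm of the difference.  (For unitary `U n` this is the same as
convergence of the entries, uniformly in the entry, since the mixing matrix is then doubly
stochastic.) -/
def IsSedentary (S : Set ℕ) {A : S → Type*} [∀ n, Fintype (A n)] [∀ n, DecidableEq (A n)]
    (U : ∀ n, Matrix (A n) (A n) ℂ) : Prop :=
  ∀ t : ℕ, ∀ ε : ℝ, 0 < ε → ∃ N : ℕ, ∀ n : S, N ≤ (n : ℕ) →
    ∀ a, ∑ b, ‖mixingMatrix (U n) t a b - (1 : Matrix (A n) (A n) ℂ) a b‖ < ε

end

open Matrix

/-! Both factors of the transition matrix are reflections `2P - I`, where `P` averages over the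
fibres of a map on arcs: the face map or the tail map. In `K_n` every tail has `k = n - 1` arcs, and
self-duality gives every face length `k` as well. Row `a` of `2P` has `k` entries `2 / k`, hence
norm `2 / √k`: each reflection is close to `-I` on basis vectors, and the two signs cancel in the
product. One step thus moves a basis vector by at most `4 / √k` (`norm_row_mul_sub_le`), and by
orthogonality `t` steps move it by at most `4t / √k` (`norm_row_pow_sub_le`). Passing to squared
entries costs a factor 4 (`sum_abs_sq_sub_one_le`), so for fixed `t` the row sums are `O(1 / √n)`.
-/

/-- The `0`-`1` incidence matrix of the fibres of a function. -/
noncomputable def fibreMatrix {D K : Type*} [DecidableEq K] (φ : D → K) : Matrix D K ℝ :=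
  Matrix.of fun d v => if φ d = v then 1 else 0

/-- The reflection about the functions that are constant on the fibres of `φ`. -/
noncomputable def fibreReflection {D K : Type*} [Fintype D] [DecidableEq D] [Fintype K]
    [DecidableEq K] (φ : D → K) : Matrix D D ℝ :=
  (2 : ℝ) • (normalizeCols (fibreMatrix φ) * (normalizeCols (fibreMatrix φ))ᵀ) - 1

lemma sum_fibreMatrix_sq {D K : Type*} [Fintype D] [DecidableEq K] {φ : D → K} {k : ℕ}
    (hφ : ∀ v, (Finset.univ.filter fun d => φ d = v).card = k) (v : K) :
    ∑ d, fibreMatrix φ d v ^ 2 = k := by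
  simp [fibreMatrix, ite_pow, Finset.sum_boole, hφ v]

/-! ### Reflections attached to maps with equal fibres -/

section Fibres

variable {D K : Type*} [Fintype D] [DecidableEq D] [Fintype K] [DecidableEq K] {φ : D → K} {k : ℕ}

lemma fibreProjection_apply (hφ : ∀ v, (Finset.univ.filter fun d => φ d = v).card = k) (d e : D) :
    (normalizeCols (fibreMatrix φ) * (normalizeCols (fibreMatrix φ))ᵀ) d e =
      if φ d = φ e then (k : ℝ)⁻¹ else 0 := by
  have h : ∀ v, (normalizeCols (fibreMatrix φ)) d v * (normalizeCols (fibreMatrix φ)) e v =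
      if φ d = v then (if φ d = φ e then (k : ℝ)⁻¹ else 0) else 0 := by
    intro v
    simp only [normalizeCols, Matrix.of_apply, sum_fibreMatrix_sq hφ]
    rw [div_mul_div_comm, Real.mul_self_sqrt (Nat.cast_nonneg k)]
    by_cases h₁ : φ d = v
    · subst h₁
      simp [fibreMatrix, eq_comm, ite_div]
    · simp [fibreMatrix, h₁]
  simp [Matrix.mul_apply, h]

lemma normalizeCols_fibreMatrix_transpose_mul_self (hk : k ≠ 0)
    (hφ : ∀ v, (Finset.univ.filter fun d => φ d = v).card = k) :
    (normalizeCols (fibreMatrix φ))ᵀ * normalizeCols (fibreMatrix φ) = 1 := by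
  ext v w
  have hk' : (k : ℝ) ≠ 0 := Nat.cast_ne_zero.mpr hk
  simp only [Matrix.mul_apply, Matrix.transpose_apply, normalizeCols, Matrix.of_apply,
    sum_fibreMatrix_sq hφ, div_mul_div_comm, Real.mul_self_sqrt (Nat.cast_nonneg k)]
  rw [← Finset.sum_div]
  by_cases h : v = w
  · subst h
    simp only [← sq, sum_fibreMatrix_sq hφ, Matrix.one_apply_eq, div_self hk']
  · rw [Matrix.one_apply_ne h, Finset.sum_eq_zero, zero_div]
    intro d _
    by_cases h₁ : φ d = v
    · simp [fibreMatrix, h₁, h]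
    · simp [fibreMatrix, h₁]

lemma fibreReflection_transpose : (fibreReflection φ)ᵀ = fibreReflection φ := by
  simp [fibreReflection, Matrix.transpose_mul]

lemma fibreReflection_mul_self (hk : k ≠ 0)
    (hφ : ∀ v, (Finset.univ.filter fun d => φ d = v).card = k) :
    fibreReflection φ * fibreReflection φ = 1 := by
  have h := normalizeCols_fibreMatrix_transpose_mul_self hk hφ
  simp only [fibreReflection]
  set B := normalizeCols (fibreMatrix φ)
  have hP : B * Bᵀ * (B * Bᵀ) = B * Bᵀ := by
    rw [Matrix.mul_assoc, ← Matrix.mul_assoc Bᵀ, h, Matrix.one_mul]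
  simp only [sub_mul, mul_sub, Matrix.smul_mul, Matrix.mul_smul, hP, Matrix.one_mul,
    Matrix.mul_one]
  module

lemma norm_fibreReflection_row (hk : k ≠ 0)
    (hφ : ∀ v, (Finset.univ.filter fun d => φ d = v).card = k) (a : D) :
    ‖WithLp.toLp 2 (Pi.single a 1 ᵥ* fibreReflection φ + Pi.single a 1)‖ = 2 / √k := by
  have hk' : (k : ℝ) ≠ 0 := Nat.cast_ne_zero.mpr hk
  have h : ∀ d, (Pi.single a 1 ᵥ* fibreReflection φ + Pi.single a 1 : D → ℝ) d =
      if φ a = φ d then 2 * (k : ℝ)⁻¹ else 0 := by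
    intro d
    rw [Pi.add_apply, Matrix.single_one_vecMul, Matrix.row_apply, fibreReflection, Matrix.sub_apply,
      Matrix.smul_apply, fibreProjection_apply hφ, Matrix.one_apply]
    by_cases had : a = d
    · subst had; simp
    · simp [had]
  rw [EuclideanSpace.norm_eq, ← Real.sqrt_sq (show (0 : ℝ) ≤ 2 / √k by positivity)]
  congr 1
  rw [div_pow, Real.sq_sqrt (Nat.cast_nonneg k)]
  have hc := hφ (φ a)
  simp only [eq_comm (b := φ a)] at hc
  simp only [h, Real.norm_eq_abs, sq_abs, ite_pow]
  simp only [ne_eq, OfNat.ofNat_ne_zero, not_false_eq_true, zero_pow, ← Finset.sum_filter,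
    Finset.sum_const, hc, nsmul_eq_mul]
  field_simp

end Fibres

/-! ### Displacement of basis vectors under orthogonal matrices -/

section Orthogonal

variable {D : Type*} [Fintype D] [DecidableEq D]

lemma norm_vecMul_of_mul_transpose {W : Matrix D D ℝ} (hW : W * Wᵀ = 1) (v : D → ℝ) :
    ‖WithLp.toLp 2 (v ᵥ* W)‖ = ‖WithLp.toLp 2 v‖ := by
  have h : (v ᵥ* W) ⬝ᵥ (v ᵥ* W) = v ⬝ᵥ v := by
    rw [← Matrix.dotProduct_mulVec, ← Matrix.vecMul_transpose W, Matrix.vecMul_vecMul, hW,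
      Matrix.vecMul_one]
  simp only [dotProduct, ← sq] at h
  simp [EuclideanSpace.norm_eq, h]

lemma norm_row_mul_sub_le {R₁ R₂ : Matrix D D ℝ} (h₂ : R₂ * R₂ᵀ = 1) (v : D → ℝ) :
    ‖WithLp.toLp 2 (v ᵥ* (R₁ * R₂) - v)‖ ≤
      ‖WithLp.toLp 2 (v ᵥ* R₁ + v)‖ + ‖WithLp.toLp 2 (v ᵥ* R₂ + v)‖ := by
  have h : v ᵥ* (R₁ * R₂) - v = (v ᵥ* R₁ + v) ᵥ* R₂ - (v ᵥ* R₂ + v) := by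
    rw [Matrix.add_vecMul, Matrix.vecMul_vecMul]; abel
  rw [h, WithLp.toLp_sub, ← norm_vecMul_of_mul_transpose h₂ (v ᵥ* R₁ + v)]
  exact norm_sub_le _ _

/-- Each step adds one displacement `vW - v`, and multiplying the earlier error by `W` preserves its
norm. -/
lemma norm_row_pow_sub_le {W : Matrix D D ℝ} (hW : W * Wᵀ = 1) (v : D → ℝ) (t : ℕ) :
    ‖WithLp.toLp 2 (v ᵥ* W ^ t - v)‖ ≤ t * ‖WithLp.toLp 2 (v ᵥ* W - v)‖ := by
  induction t with
  | zero => simp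
  | succ t ih =>
    have h : v ᵥ* W ^ (t + 1) - v = (v ᵥ* W ^ t - v) ᵥ* W + (v ᵥ* W - v) := by
      rw [Matrix.sub_vecMul, Matrix.vecMul_vecMul, pow_succ]; abel
    rw [h, WithLp.toLp_add]
    refine (norm_add_le _ _).trans ?_
    rw [norm_vecMul_of_mul_transpose hW]
    push_cast
    linarith

/-- The squared entries of a row sum to 1, so the off-diagonal mass equals the diagonal defect `1 -
W a a ^ 2`, which is at most `2 * |W a a - 1|`. -/
lemma sum_abs_sq_sub_one_le {W : Matrix D D ℝ} (hW : W * Wᵀ = 1) (a : D) :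
    ∑ b, |W a b ^ 2 - (1 : Matrix D D ℝ) a b| ≤
      4 * ‖WithLp.toLp 2 (Pi.single a 1 ᵥ* W - Pi.single a 1)‖ := by
  have hrow : ∑ b, W a b ^ 2 = 1 := by
    have := congrFun (congrFun hW a) a
    simpa [Matrix.mul_apply, sq] using this
  have hle : W a a ^ 2 ≤ 1 := by
    rw [← hrow]
    exact Finset.single_le_sum (f := fun b => W a b ^ 2) (fun _ _ => sq_nonneg _)
      (Finset.mem_univ a)
  have hδ : |W a a - 1| ≤ ‖WithLp.toLp 2 (Pi.single a 1 ᵥ* W - Pi.single a 1)‖ := by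
    have := PiLp.norm_apply_le (WithLp.toLp 2 (Pi.single a 1 ᵥ* W - Pi.single a 1)) a
    simpa [Matrix.single_one_vecMul] using this
  have hsum : ∑ b, |W a b ^ 2 - (1 : Matrix D D ℝ) a b| = 2 * (1 - W a a ^ 2) := by
    rw [← Finset.add_sum_erase _ _ (Finset.mem_univ a)] at hrow ⊢
    rw [Matrix.one_apply_eq, abs_of_nonpos (by linarith)]
    have : ∑ b ∈ Finset.univ.erase a, |W a b ^ 2 - (1 : Matrix D D ℝ) a b| =
        ∑ b ∈ Finset.univ.erase a, W a b ^ 2 := by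
      refine Finset.sum_congr rfl fun b hb => ?_
      rw [Matrix.one_apply_ne (Finset.ne_of_mem_erase hb).symm, sub_zero, abs_of_nonneg
        (sq_nonneg _)]
    linarith
  rw [hsum]
  nlinarith [neg_abs_le (W a a - 1), sq_nonneg (W a a - 1)]

lemma norm_mixingMatrix_map_ofReal (W : Matrix D D ℝ) (t : ℕ) (a b : D) :
    ‖mixingMatrix (W.map Complex.ofReal) t a b - (1 : Matrix D D ℂ) a b‖ =
      |(W ^ t) a b ^ 2 - (1 : Matrix D D ℝ) a b| := by
  have hpow : (W.map Complex.ofReal) ^ t = (W ^ t).map Complex.ofReal :=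
    (map_pow (Complex.ofRealHom.mapMatrix (m := D)) W t).symm
  rw [← Real.norm_eq_abs, ← Complex.norm_real, mixingMatrix, hpow]
  congr 1
  by_cases h : a = b <;> simp [Matrix.one_apply, h, sq]

end Orthogonal

/-- If `φ` and `ψ` have all fibres of size `k`, the walk whose step is the product of the two
fibre reflections moves every state by at most `4 / √k` in one step. -/
lemma sum_norm_mixingMatrix_le {D K L : Type*} [Fintype D] [DecidableEq D] [Fintype K]
    [DecidableEq K] [Fintype L] [DecidableEq L] {φ : D → K} {ψ : D → L} {k : ℕ} (hk : k ≠ 0)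
    (hφ : ∀ v, (Finset.univ.filter fun d => φ d = v).card = k)
    (hψ : ∀ v, (Finset.univ.filter fun d => ψ d = v).card = k) (t : ℕ) (a : D) :
    ∑ b, ‖mixingMatrix ((fibreReflection φ * fibreReflection ψ).map Complex.ofReal) t a b -
      (1 : Matrix D D ℂ) a b‖ ≤ 16 * t / √k := by
  have h₁ : fibreReflection φ * (fibreReflection φ)ᵀ = 1 := by
    rw [fibreReflection_transpose, fibreReflection_mul_self hk hφ]
  have h₂ : fibreReflection ψ * (fibreReflection ψ)ᵀ = 1 := by
    rw [fibreReflection_transpose, fibreReflection_mul_self hk hψ]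
  set W := fibreReflection φ * fibreReflection ψ with hWdef
  have hW : W * Wᵀ = 1 := by
    rw [hWdef, Matrix.transpose_mul, Matrix.mul_assoc, ← Matrix.mul_assoc (fibreReflection ψ), h₂,
      Matrix.one_mul, h₁]
  -- `W` commutes with its transpose, which is its inverse, so the powers combine into `(W * Wᵀ) ^
  -- t`.
  have hWt : W ^ t * (W ^ t)ᵀ = 1 := by
    rw [Matrix.transpose_pow]
    exact (Commute.mul_pow (show Commute W Wᵀ from hW.trans (mul_eq_one_comm.mp hW).symm)
      t).symm.trans (by rw [hW, one_pow])
  simp only [norm_mixingMatrix_map_ofReal]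
  have hstep := norm_row_mul_sub_le (R₁ := fibreReflection φ) h₂ (Pi.single a 1)
  rw [norm_fibreReflection_row hk hφ, norm_fibreReflection_row hk hψ, ← hWdef] at hstep
  calc _ ≤ 4 * ‖WithLp.toLp 2 (Pi.single a 1 ᵥ* W ^ t - Pi.single a 1)‖ :=
        sum_abs_sq_sub_one_le hWt a
    _ ≤ 4 * (t * (2 / √k + 2 / √k)) := by
        refine mul_le_mul_of_nonneg_left ?_ (by norm_num)
        exact (norm_row_pow_sub_le hW _ t).trans
          (mul_le_mul_of_nonneg_left hstep (Nat.cast_nonneg t))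
    _ = 16 * t / √k := by ring

/-! ### Fibre sizes in the embedding, and the limit -/

lemma card_filter_dart_fst {V : Type*} [Fintype V] [DecidableEq V] (G : SimpleGraph V)
    [DecidableRel G.Adj] (v : V) :
    (Finset.univ.filter fun d : G.Dart => d.fst = v).card = G.degree v :=
  G.dart_fst_fiber_card_eq_degree v

open Classical in
/-- In a self-dual embedding, the length of a face is the degree of the corresponding vertex. -/
lemma RotationSystem.IsSelfDual.card_filter_faceOf {V : Type*} [Fintype V]
    {G : SimpleGraph V} [DecidableRel G.Adj] {M : RotationSystem G} {k : ℕ} (hM : M.IsSelfDual)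
    (hG : G.IsRegularOfDegree k) (F : M.Face) :
    (Finset.univ.filter fun d : G.Dart => M.faceOf d = F).card = k := by
  obtain ⟨f, g, -, hg⟩ := hM
  rw [← hG (f F), ← card_filter_dart_fst]
  -- The arc bijection `g` carries the arcs of the face `F` onto the arcs with tail `f F`.
  refine Finset.card_equiv g fun d => ?_
  simp [hg]

lemma RotationSystem.transition_eq {V : Type*} [Fintype V] [DecidableEq V] {G : SimpleGraph V}
    [DecidableRel G.Adj] [DecidableEq G.Dart] (M : RotationSystem G) [DecidableEq M.Face] :
    M.transition =
      (fibreReflection M.faceOf * fibreReflection fun d : G.Dart => d.fst).map Complex.ofReal := by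
  have h₁ : M.arcFace = fibreMatrix M.faceOf := by
    ext d F; simp [RotationSystem.arcFace, fibreMatrix]
  have h₂ : arcTail G = fibreMatrix fun d : G.Dart => d.fst := by
    ext d F; simp [arcTail, fibreMatrix]
  unfold RotationSystem.transition fibreReflection
  rw [h₁, h₂]
  congr!

theorem corollary7p2 (S : Set ℕ) (hS : ∀ n ∈ S, IsPrimePow n)
    (M : ∀ n : S, RotationSystem (⊤ : SimpleGraph (Fin (n : ℕ))))
    (hreg : ∀ n, (M n).IsOrientablyRegular) (hdual : ∀ n, (M n).IsSelfDual) :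
    IsSedentary S (fun n => (M n).transition) := by
  classical
  intro t ε hε
  -- Solves `16 * t / √(n - 1) < ε` for `n - 1`; the shift to `N + 2` gives both `N ≤ n - 1` and `n
  -- - 1 ≠ 0`.
  obtain ⟨N, hN⟩ := exists_nat_gt ((16 * t / ε) ^ 2)
  refine ⟨N + 2, fun n hn a => ?_⟩
  have hdeg : (⊤ : SimpleGraph (Fin (n : ℕ))).IsRegularOfDegree ((n : ℕ) - 1) := fun v => by
    simp
  have hk : (n : ℕ) - 1 ≠ 0 := by omega
  have hbound := sum_norm_mixingMatrix_le hk
    (fun F => by convert (hdual n).card_filter_faceOf hdeg F)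
    (fun v => (card_filter_dart_fst (⊤ : SimpleGraph (Fin (n : ℕ))) v).trans (hdeg v)) t a
  rw [← RotationSystem.transition_eq] at hbound
  refine lt_of_le_of_lt hbound ?_
  have hNk : (N : ℝ) ≤ (((n : ℕ) - 1 : ℕ) : ℝ) := by
    exact_mod_cast (by omega : N ≤ (n : ℕ) - 1)
  have hsqrt : 16 * t / ε < √(((n : ℕ) - 1 : ℕ) : ℝ) :=
    Real.lt_sqrt_of_sq_lt (hN.trans_le hNk)
  have hpos : 0 < √(((n : ℕ) - 1 : ℕ) : ℝ) := lt_of_le_of_lt (by positivity) hsqrt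
  rw [div_lt_iff₀ hpos]
  rwa [div_lt_iff₀ hε, mul_comm _ ε] at hsqrt
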